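/- There exist absolute constants $c_1, c_2, C > 0$ and $q_0$ such that the following holds. Let $q \ge q_0$ be a squarefree integer with $$\sum_{p\mid q} \frac{\log p}{p} \;\ge\; 60 \log\log\log q,$$ where $p$ runs over the prime divisors of $q$, and set $z = \Big(\prod_{p\mid q} p^{1/p}\Big)^{c_1}$. Then for every real number $u$ with $$C\left(\frac{\log\log q}{\log z}\right)^{3} \le u \le \sqrt{z}$$ there exist intervals $I_+$ and $I_-$ of the form $(m, m+h]$, where $m,h \ge 0$ are integers and the length $|I_\pm| = h$ is at least $z^u$, such that $$\#\{n\in I_+\cap\mathbb{Z} : (n,q)=1\} \ge \left(1+\frac{1}{u^{c_2u}}\right)\frac{\varphi(q)}{q}|I_+|$$ and $$\#\{n\in I_-\cap\mathbb{Z} : (n,q)=1\} \le \left(1-\frac{1}{u^{c_2u}}\right)\frac{\varphi(q)}{q}|I_-|.$$ -/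

import Mathlib

/-- The sum `∑_{p ∣ q} (log p) / p` over the prime divisors of `q`. -/
noncomputable def primeLogSum (q : ℕ) : ℝ :=
  ∑ p ∈ q.primeFactors, Real.log (p : ℝ) / (p : ℝ)

/-- The parameter `z = (∏_{p ∣ q} p ^ (1 / p)) ^ c`, the product being over the prime divisors
of `q`. -/
noncomputable def zParam (c : ℝ) (q : ℕ) : ℝ :=
  (∏ p ∈ q.primeFactors, (p : ℝ) ^ (1 / (p : ℝ))) ^ c

/-- The number of integers `n` in the interval `(m, m + h]` (of length `h`) that are coprime
to `q`. -/
def coprimeCount (q m h : ℕ) : ℕ :=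
  ((Finset.Ioc m (m + h)).filter (fun n => Nat.Coprime n q)).card

/-! Averaging over shifts by multiples of `Q` shows that a bias among the first `h` integers for one
divisor `Q ∣ q` is inherited by `q` on some interval of length `h` (`exists_le_coprimeCount_mul`,
`exists_coprimeCount_mul_le`). So it suffices to find a biased `Q`.

Take `Q = ∏ p ∈ P` with all primes of `P` just above some `w`, and `h = w ^ (k + 1) - 1` with `k`
about `u`. In inclusion-exclusion, the terms `⌊h / d⌋` with `d` a product of more than `k` primes
vanish, while the expected value `h * ∏ (1 - 1 / p)` includes them. The degree `k + 1` term
dominates the discrepancy: rounding errors in lower degrees and the tail of higher degrees are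
smaller (`coprimeCount_deviation`). Its sign is `(-1) ^ k`, so the parity of `k` decides between
excess and deficit, and its relative size is at least `u ^ (-O(u))` because the reciprocals of `P`
sum to at least `1 / u ^ 2`.

Such a `P` comes from Mertens' upper bound and a pigeonhole on `log p` (`exists_prime_cluster`). -/

/-- The elementary symmetric sum of degree `j` of the values `f i`, `i ∈ s`. -/
noncomputable def elemSymm {ι : Type*} (f : ι → ℝ) (s : Finset ι) (j : ℕ) : ℝ :=
  ∑ T ∈ s.powersetCard j, ∏ i ∈ T, f i

lemma elemSymm_zero {ι : Type*} (f : ι → ℝ) (s : Finset ι) : elemSymm f s 0 = 1 := by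
  simp [elemSymm]

lemma elemSymm_nonneg {ι : Type*} {f : ι → ℝ} (hf : ∀ i, 0 ≤ f i) (s : Finset ι) (j : ℕ) :
    0 ≤ elemSymm f s j :=
  Finset.sum_nonneg fun _ _ => Finset.prod_nonneg fun i _ => hf i

/-- Double counting of pairs (set of size `j + 1`, marked element), with the marked element removed
or inserted. Both bounds on consecutive ratios below follow from it. -/
lemma succ_mul_elemSymm_succ {ι : Type*} [DecidableEq ι] (f : ι → ℝ) (s : Finset ι) (j : ℕ) :
    (j + 1 : ℝ) * elemSymm f s (j + 1) =
      ∑ T ∈ s.powersetCard j, (∑ i ∈ s \ T, f i) * ∏ i ∈ T, f i := by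
  have h1 : (j + 1 : ℝ) * elemSymm f s (j + 1) =
      ∑ T ∈ s.powersetCard (j + 1), ∑ i ∈ T, f i * ∏ l ∈ T.erase i, f l := by
    rw [elemSymm, Finset.mul_sum]
    refine Finset.sum_congr rfl fun T hT => ?_
    rw [Finset.sum_congr rfl fun i hi => Finset.mul_prod_erase T f hi, Finset.sum_const,
      (Finset.mem_powersetCard.1 hT).2]
    simp
  rw [h1]
  simp_rw [Finset.sum_mul]
  rw [Finset.sum_sigma', Finset.sum_sigma']
  refine Finset.sum_bij' (fun x _ => ⟨x.1.erase x.2, x.2⟩) (fun x _ => ⟨insert x.2 x.1, x.2⟩)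
    ?_ ?_ ?_ ?_ ?_
  · rintro ⟨T, i⟩ h
    simp only [Finset.mem_sigma, Finset.mem_powersetCard, Finset.mem_sdiff] at h ⊢
    refine ⟨⟨(Finset.erase_subset _ _).trans h.1.1, ?_⟩, h.1.1 h.2, by simp⟩
    rw [Finset.card_erase_of_mem h.2, h.1.2]; rfl
  · rintro ⟨T, i⟩ h
    simp only [Finset.mem_sigma, Finset.mem_powersetCard, Finset.mem_sdiff] at h ⊢
    refine ⟨⟨Finset.insert_subset h.2.1 h.1.1, ?_⟩, by simp⟩
    rw [Finset.card_insert_of_notMem h.2.2, h.1.2]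
  · rintro ⟨T, i⟩ h
    simp only [Finset.mem_sigma] at h
    simp [Finset.insert_erase h.2]
  · rintro ⟨T, i⟩ h
    simp only [Finset.mem_sigma, Finset.mem_sdiff] at h
    simp [Finset.erase_insert h.2.2]
  · rintro ⟨T, i⟩ h
    rfl

lemma succ_mul_elemSymm_succ_le {ι : Type*} {f : ι → ℝ} (hf : ∀ i, 0 ≤ f i)
    (s : Finset ι) (j : ℕ) :
    (j + 1 : ℝ) * elemSymm f s (j + 1) ≤ (∑ i ∈ s, f i) * elemSymm f s j := by
  classical
  rw [succ_mul_elemSymm_succ, elemSymm, Finset.mul_sum]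
  refine Finset.sum_le_sum fun T _ =>
    mul_le_mul_of_nonneg_right ?_ (Finset.prod_nonneg fun i _ => hf i)
  exact Finset.sum_le_sum_of_subset_of_nonneg Finset.sdiff_subset fun i _ _ => hf i

lemma le_succ_mul_elemSymm_succ {ι : Type*} {f : ι → ℝ} (hf : ∀ i, 0 ≤ f i)
    {s : Finset ι} {b : ℝ} (hb : ∀ i ∈ s, f i ≤ b) (j : ℕ) :
    (∑ i ∈ s, f i - j * b) * elemSymm f s j ≤ (j + 1 : ℝ) * elemSymm f s (j + 1) := by
  classical
  rw [succ_mul_elemSymm_succ, elemSymm, Finset.mul_sum]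
  refine Finset.sum_le_sum fun T hT =>
    mul_le_mul_of_nonneg_right ?_ (Finset.prod_nonneg fun i _ => hf i)
  obtain ⟨hTs, hTc⟩ := Finset.mem_powersetCard.1 hT
  rw [← Finset.sum_sdiff hTs]
  have : ∑ i ∈ T, f i ≤ T.card • b := Finset.sum_le_card_nsmul _ _ _ fun i hi => hb i (hTs hi)
  rw [hTc, nsmul_eq_mul] at this
  linarith

lemma prod_one_sub_eq_sum_elemSymm {ι : Type*} (f : ι → ℝ) (s : Finset ι) :
    ∏ i ∈ s, (1 - f i) = ∑ j ∈ Finset.range (s.card + 1), (-1) ^ j * elemSymm f s j := by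
  simp_rw [sub_eq_add_neg]
  rw [Finset.prod_one_add, Finset.sum_powerset]
  refine Finset.sum_congr rfl fun j _ => ?_
  rw [elemSymm, Finset.mul_sum]
  refine Finset.sum_congr rfl fun T hT => ?_
  rw [Finset.prod_neg, (Finset.mem_powersetCard.1 hT).2]

lemma elemSymm_eq_zero {ι : Type*} (f : ι → ℝ) {s : Finset ι} {j : ℕ} (h : s.card < j) :
    elemSymm f s j = 0 := by
  simp [elemSymm, Finset.powersetCard_eq_empty.2 h]

/-! ### Coprime counts, and passing from a divisor to its multiple -/

lemma coprimeCount_eq (q m h : ℕ) :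
    coprimeCount q m h = ∑ n ∈ Finset.Ioc 0 h, if Nat.Coprime (m + n) q then 1 else 0 := by
  have : Finset.Ioc m (m + h) = (Finset.Ioc 0 h).image (m + ·) := by
    simp [Finset.image_add_left_Ioc]
  rw [coprimeCount, Finset.card_filter, this, Finset.sum_image]
  intro a _ b _ hab
  simpa using hab

/-- `Q` is invertible modulo `R`, so `t ↦ Q * t + n` permutes the residues modulo `R`. -/
lemma card_range_coprime_add_mul {Q R : ℕ} (hR : 0 < R) (hQR : Q.Coprime R) (n : ℕ) :
    ((Finset.range R).filter fun t => Nat.Coprime (Q * t + n) R).card = R.totient := by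
  have hinj : Set.InjOn (fun t => (Q * t + n) % R) (Finset.range R) := by
    intro a ha b hb hab
    have h1 : Q * a ≡ Q * b [MOD R] := Nat.ModEq.add_right_cancel' n hab
    have h2 : a ≡ b [MOD R] := Nat.ModEq.cancel_left_of_coprime hQR.symm h1
    exact Nat.ModEq.eq_of_lt_of_lt h2 (by simpa using ha) (by simpa using hb)
  have himg : (Finset.range R).image (fun t => (Q * t + n) % R) = Finset.range R := by
    refine Finset.eq_of_subset_of_card_le ?_ ?_
    · intro x hx
      obtain ⟨t, _, rfl⟩ := Finset.mem_image.1 hx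
      exact Finset.mem_range.2 (Nat.mod_lt _ hR)
    · rw [Finset.card_image_of_injOn hinj]
  rw [Nat.totient, Finset.card_filter, Finset.card_filter]
  conv_rhs => rw [← himg]
  rw [Finset.sum_image hinj]
  refine Finset.sum_congr rfl fun t _ => ?_
  have : Nat.Coprime (Q * t + n) R ↔ Nat.Coprime R ((Q * t + n) % R) := by
    rw [Nat.coprime_comm, Nat.Coprime, Nat.Coprime, Nat.gcd_rec, Nat.gcd_comm]
  simp [this]

/-- The average over shifts by multiples of `Q` of the number of integers coprime to `Q * R`. -/
lemma sum_coprimeCount_mul {Q R : ℕ} (hR : 0 < R) (hQR : Q.Coprime R) (h : ℕ) :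
    ∑ t ∈ Finset.range R, coprimeCount (Q * R) (Q * t) h = coprimeCount Q 0 h * R.totient := by
  simp_rw [coprimeCount_eq]
  rw [Finset.sum_comm, Finset.sum_mul]
  refine Finset.sum_congr rfl fun n _ => ?_
  have : ∀ t, Nat.Coprime (Q * t + n) (Q * R) ↔ Nat.Coprime n Q ∧
      Nat.Coprime (Q * t + n) R := by
    intro t
    rw [Nat.coprime_mul_iff_right]
    simp
  simp only [this, zero_add]
  rw [← card_range_coprime_add_mul hR hQR n, Finset.card_filter]
  by_cases hn : Nat.Coprime n Q
  · rw [if_pos hn, one_mul]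
    exact Finset.sum_congr rfl fun t _ => if_congr (and_iff_right hn) rfl rfl
  · rw [if_neg hn, zero_mul]
    exact Finset.sum_eq_zero fun t _ => if_neg fun h => hn h.1

lemma exists_le_coprimeCount_mul {Q R : ℕ} (hQ : 0 < Q) (hR : 0 < R) (hQR : Q.Coprime R) {h : ℕ}
    {c : ℝ} (hc : c * ((Nat.totient Q : ℝ) / Q) * h ≤ coprimeCount Q 0 h) :
    ∃ m : ℕ, c * ((Nat.totient (Q * R) : ℝ) / ((Q * R : ℕ) : ℝ)) * h ≤
      coprimeCount (Q * R) m h := by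
  have hsum := congrArg (Nat.cast (R := ℝ)) (sum_coprimeCount_mul hR hQR h)
  push_cast at hsum
  have hR' : (0 : ℝ) < R := by exact_mod_cast hR
  obtain ⟨t, -, ht⟩ := Finset.exists_le_of_sum_le (s := Finset.range R)
    (f := fun _ => c * ((Nat.totient (Q * R) : ℝ) / ((Q * R : ℕ) : ℝ)) * h)
    (g := fun t => (coprimeCount (Q * R) (Q * t) h : ℝ)) ⟨0, by simpa using hR⟩ (by
      rw [hsum, Finset.sum_const, Finset.card_range, nsmul_eq_mul, Nat.totient_mul hQR]
      push_cast
      calc _ = (c * ((Nat.totient Q : ℝ) / Q) * h) * R.totient := by field_simp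
        _ ≤ _ := by gcongr)
  exact ⟨_, ht⟩

lemma exists_coprimeCount_mul_le {Q R : ℕ} (hQ : 0 < Q) (hR : 0 < R) (hQR : Q.Coprime R) {h : ℕ}
    {c : ℝ} (hc : coprimeCount Q 0 h ≤ c * ((Nat.totient Q : ℝ) / Q) * h) :
    ∃ m : ℕ, coprimeCount (Q * R) m h ≤
      c * ((Nat.totient (Q * R) : ℝ) / ((Q * R : ℕ) : ℝ)) * h := by
  have hsum := congrArg (Nat.cast (R := ℝ)) (sum_coprimeCount_mul hR hQR h)
  push_cast at hsum
  have hR' : (0 : ℝ) < R := by exact_mod_cast hR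
  obtain ⟨t, -, ht⟩ := Finset.exists_le_of_sum_le (s := Finset.range R)
    (g := fun _ => c * ((Nat.totient (Q * R) : ℝ) / ((Q * R : ℕ) : ℝ)) * h)
    (f := fun t => (coprimeCount (Q * R) (Q * t) h : ℝ)) ⟨0, by simpa using hR⟩ (by
      rw [hsum, Finset.sum_const, Finset.card_range, nsmul_eq_mul, Nat.totient_mul hQR]
      push_cast
      calc _ ≤ (c * ((Nat.totient Q : ℝ) / Q) * h) * R.totient := by gcongr
        _ = _ := by field_simp)
  exact ⟨_, ht⟩

/-! ### Mertens' upper bound -/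

lemma pow_div_dvd_factorial {p : ℕ} (hp : 0 < p) (n : ℕ) : p ^ (n / p) ∣ n.factorial := by
  have key : ∀ k, p ^ k ∣ (p * k).factorial := by
    intro k
    induction k with
    | zero => simp
    | succ k ih =>
      have h1 : (p * k).factorial * (p * (k + 1)) ∣ (p * (k + 1)).factorial := by
        obtain ⟨r, hr⟩ : ∃ r, p * (k + 1) = r + 1 := ⟨p * (k + 1) - 1, by
          have : 0 < p * (k + 1) := by positivity
          omega⟩
        rw [hr, Nat.factorial_succ, mul_comm]
        refine mul_dvd_mul_left _ (Nat.factorial_dvd_factorial ?_)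
        have : p * (k + 1) = p * k + p := by ring
        omega
      refine dvd_trans ?_ h1
      rw [pow_succ]
      exact mul_dvd_mul ih (dvd_mul_right _ _)
  exact (key _).trans (Nat.factorial_dvd_factorial (Nat.mul_div_le n p))

/-- An upper bound in Mertens' first theorem. -/
lemma sum_log_div_le {n : ℕ} (hn : 0 < n) {s : Finset ℕ} (hs : ∀ p ∈ s, p.Prime ∧ p ≤ n) :
    ∑ p ∈ s, Real.log p / p ≤ Real.log n + 2 := by
  have hdvd : ∏ p ∈ s, p ^ (n / p) ∣ n.factorial := by
    refine Finset.prod_dvd_of_isRelPrime ?_ fun p hp => pow_div_dvd_factorial (hs p hp).1.pos n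
    intro p hp r hr hne
    exact Nat.coprime_iff_isRelPrime.1 <| Nat.Coprime.pow _ _ <|
      (Nat.coprime_primes (hs p hp).1 (hs r hr).1).2 hne
  have hle : ∏ p ∈ s, p ^ (n / p) ≤ n ^ n :=
    (Nat.le_of_dvd (Nat.factorial_pos n) hdvd).trans (Nat.factorial_le_pow n)
  have hn' : (0 : ℝ) < n := by exact_mod_cast hn
  have hlog : ∑ p ∈ s, ((n / p : ℕ) : ℝ) * Real.log p ≤ n * Real.log n := by
    have h1 : ((∏ p ∈ s, p ^ (n / p) : ℕ) : ℝ) ≤ (n : ℝ) ^ n := by exact_mod_cast hle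
    have h2 := Real.log_le_log (by
      push_cast
      exact Finset.prod_pos fun p hp => by
        have := (hs p hp).1.pos
        positivity) h1
    push_cast at h2
    rw [Real.log_prod (fun p hp => by
      have := (hs p hp).1.pos
      positivity), Real.log_pow] at h2
    simpa [Real.log_pow] using h2
  -- This pays for replacing `n / p` by its integer part.
  have htheta : ∑ p ∈ s, Real.log p ≤ Real.log 4 * n := by
    refine le_trans ?_ (Chebyshev.theta_le_log4_mul_x hn'.le)
    rw [Chebyshev.theta_eq_sum_Icc, Nat.floor_natCast]
    refine Finset.sum_le_sum_of_subset_of_nonneg ?_ fun p _ _ => Real.log_natCast_nonneg p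
    intro p hp
    simp [hs p hp]
  have hlog4 : Real.log 4 ≤ 2 := by
    have : Real.log 4 = 2 * Real.log 2 := by
      rw [show (4 : ℝ) = 2 ^ 2 by norm_num, Real.log_pow]; norm_num
    have := Real.log_two_lt_d9
    linarith
  have hterm : ∀ p ∈ s, n * (Real.log p / p) ≤ ((n / p : ℕ) : ℝ) * Real.log p + Real.log p := by
    intro p hp
    have h1 : (n : ℝ) / p ≤ ((n / p : ℕ) : ℝ) + 1 := by
      have := Nat.lt_floor_add_one ((n : ℝ) / p)
      rw [Nat.floor_div_eq_div] at this
      exact this.le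
    have := mul_le_mul_of_nonneg_right h1 (Real.log_natCast_nonneg p)
    calc _ = (n : ℝ) / p * Real.log p := by ring
      _ ≤ _ := by linarith
  have := Finset.sum_le_sum hterm
  rw [← Finset.mul_sum, Finset.sum_add_distrib] at this
  have h3 : n * ∑ p ∈ s, Real.log p / p ≤ n * (Real.log n + 2) := by nlinarith
  exact le_of_mul_le_mul_left h3 hn'

/-! ### Inclusion-exclusion and the dominant term -/

lemma coprimeCount_prod_eq {P : Finset ℕ} (hP : ∀ p ∈ P, p.Prime) (h : ℕ) :
    (coprimeCount (∏ p ∈ P, p) 0 h : ℝ) = ∑ j ∈ Finset.range (P.card + 1),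
      (-1) ^ j * ∑ T ∈ P.powersetCard j, ((h / ∏ p ∈ T, p : ℕ) : ℝ) := by
  have hind : ∀ n : ℕ, (if Nat.Coprime (0 + n) (∏ p ∈ P, p) then (1 : ℝ) else 0) =
      ∑ j ∈ Finset.range (P.card + 1), (-1) ^ j *
        ∑ T ∈ P.powersetCard j, if ∏ p ∈ T, p ∣ n then (1 : ℝ) else 0 := by
    intro n
    have h1 : (if Nat.Coprime (0 + n) (∏ p ∈ P, p) then (1 : ℝ) else 0) =
        ∏ p ∈ P, (1 - if p ∣ n then (1 : ℝ) else 0) := by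
      rw [zero_add]
      split_ifs with hc
      · refine (Finset.prod_eq_one fun p hp => ?_).symm
        have := (Nat.Prime.coprime_iff_not_dvd (hP p hp)).1
          (Nat.Coprime.symm (Nat.Coprime.coprime_dvd_right (Finset.dvd_prod_of_mem _ hp) hc))
        simp [this]
      · rw [Nat.coprime_prod_right_iff] at hc
        push Not at hc
        obtain ⟨p, hp, hpn⟩ := hc
        refine (Finset.prod_eq_zero hp ?_).symm
        have : p ∣ n := by
          by_contra hnot
          exact hpn ((Nat.Prime.coprime_iff_not_dvd (hP p hp)).2 hnot).symm
        simp [this]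
    rw [h1, prod_one_sub_eq_sum_elemSymm]
    refine Finset.sum_congr rfl fun j _ => ?_
    rw [elemSymm]
    congr 1
    refine Finset.sum_congr rfl fun T hT => ?_
    have hTP := (Finset.mem_powersetCard.1 hT).1
    rw [Finset.prod_ite_zero]
    have : (∀ p ∈ T, p ∣ n) ↔ ∏ p ∈ T, p ∣ n :=
      ⟨fun hd => Finset.prod_primes_dvd n (fun p hp => (hP p (hTP hp)).prime) hd,
        fun hd p hp => (Finset.dvd_prod_of_mem _ hp).trans hd⟩
    simp [this]
  rw [coprimeCount_eq]
  push_cast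
  rw [Finset.sum_congr rfl fun n _ => hind n, Finset.sum_comm]
  refine Finset.sum_congr rfl fun j _ => ?_
  rw [← Finset.mul_sum, Finset.sum_comm]
  congr 1
  refine Finset.sum_congr rfl fun T _ => ?_
  rw [← Nat.Ioc_filter_dvd_card_eq_div, Finset.card_filter]
  push_cast
  rfl

lemma sum_range_le_two_mul {g : ℕ → ℝ} (hg : ∀ i, 0 ≤ g i) (h : ∀ i, 2 * g (i + 1) ≤ g i)
    (M : ℕ) : ∑ i ∈ Finset.range M, g i ≤ 2 * g 0 := by
  have : ∑ i ∈ Finset.range M, g i + 2 * g M ≤ 2 * g 0 := by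
    induction M with
    | zero => simp
    | succ M ih =>
      rw [Finset.sum_range_succ]
      linarith [h M]
  linarith [hg M]

lemma sum_range_le_of_doubling {g : ℕ → ℝ} (h0 : 0 ≤ g 0) {k : ℕ}
    (h : ∀ i < k, 2 * g i ≤ g (i + 1)) : ∑ i ∈ Finset.range k, g i ≤ g k := by
  induction k with
  | zero => simpa using h0
  | succ k ih =>
    rw [Finset.sum_range_succ]
    linarith [h k (by omega), ih fun i hi => h i (by omega)]

/-- If all primes of `P` are close to `w` in logarithmic scale, then the number of integers up to
`w ^ (k + 1) - 1` coprime to all of them deviates from its expected value by about the elementary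
symmetric sum of degree `k + 1` of their reciprocals, with the sign `(-1) ^ k`. -/
lemma coprimeCount_deviation {P : Finset ℕ} (hP : ∀ p ∈ P, p.Prime) {w : ℕ}
    (hw : ∀ p ∈ P, w ≤ p) {B : ℝ} (hB : 1 ≤ B) (hpB : ∀ p ∈ P, (p : ℝ) ≤ w * B) {k : ℕ}
    {a : ℝ} (ha : 1 ≤ a)
    (hstep : ∀ j ≤ k, elemSymm (fun p : ℕ => 1 / (p : ℝ)) P j ≤
      a * elemSymm (fun p : ℕ => 1 / (p : ℝ)) P (j + 1))
    (hab : 16 * a * B ^ k ≤ w) (hs : ∑ p ∈ P, 1 / (p : ℝ) ≤ (k + 2) / 8) :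
    ((w ^ (k + 1) - 1 : ℕ) : ℝ) * elemSymm (fun p : ℕ => 1 / (p : ℝ)) P (k + 1) / 2 ≤
      (-1) ^ k * (coprimeCount (∏ p ∈ P, p) 0 (w ^ (k + 1) - 1) -
        ((w ^ (k + 1) - 1 : ℕ) : ℝ) * ∏ p ∈ P, (1 - 1 / (p : ℝ))) := by
  set e := elemSymm (fun p : ℕ => 1 / (p : ℝ)) P with he
  have hf : ∀ p : ℕ, 0 ≤ 1 / (p : ℝ) := fun p => by positivity
  have he0 : ∀ j, 0 ≤ e j := fun j => elemSymm_nonneg hf P j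
  have hBk : 1 ≤ B ^ k := one_le_pow₀ hB
  have haB : a ≤ a * B ^ k := le_mul_of_one_le_right (by linarith) hBk
  have hw16 : (16 : ℝ) ≤ w := by linarith
  have hw16' : 16 ≤ w := by exact_mod_cast hw16
  have hepos : ∀ j ≤ k + 1, 0 < e j := by
    intro j hj
    induction j with
    | zero => rw [he, elemSymm_zero]; norm_num
    | succ j ih =>
      have := hstep j (by omega)
      have h2 := ih (by omega)
      by_contra hcon
      have : a * e (j + 1) ≤ 0 := mul_nonpos_of_nonneg_of_nonpos (by linarith) (not_lt.1 hcon)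
      linarith
  have hcard : k + 1 ≤ P.card := by
    by_contra hcon
    have := hepos (k + 1) le_rfl
    rw [he, elemSymm_eq_zero _ (not_le.1 hcon)] at this
    exact lt_irrefl _ this
  set h : ℕ := w ^ (k + 1) - 1 with hh
  have hwk : 16 ≤ w ^ (k + 1) := hw16'.trans (Nat.le_self_pow (by omega) w)
  have hhle : (h : ℝ) ≥ (w : ℝ) ^ (k + 1) / 2 := by
    have h1 : ((w ^ (k + 1) : ℕ) : ℝ) = h + 1 := by
      rw [hh]; exact_mod_cast (Nat.sub_add_cancel (by omega)).symm
    have h2 : (16 : ℝ) ≤ ((w ^ (k + 1) : ℕ) : ℝ) := by exact_mod_cast hwk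
    push_cast at h1 h2
    linarith
  set F : ℕ → ℝ := fun j => ∑ T ∈ P.powersetCard j, ((h / ∏ p ∈ T, p : ℕ) : ℝ) with hF
  have hprod_pos : ∀ j, ∀ T ∈ P.powersetCard j, 0 < ∏ p ∈ T, p := fun j T hT =>
    Finset.prod_pos fun p hp => (hP p ((Finset.mem_powersetCard.1 hT).1 hp)).pos
  -- The `- 1` in `h` matters here: a product of `k + 1` primes may equal `w ^ (k + 1)` at the
  -- least, and must exceed `h`.
  have hF0 : ∀ j, k + 1 ≤ j → F j = 0 := by
    intro j hj
    refine Finset.sum_eq_zero fun T hT => ?_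
    obtain ⟨hTP, hTc⟩ := Finset.mem_powersetCard.1 hT
    have h1 : w ^ j ≤ ∏ p ∈ T, p := by
      rw [← hTc]
      exact Finset.pow_card_le_prod _ _ _ fun p hp => hw p (hTP hp)
    have h2 : w ^ (k + 1) ≤ w ^ j := Nat.pow_le_pow_right (by omega) hj
    rw [Nat.div_eq_of_lt (by omega)]
    simp
  -- Each integer part costs at most `1`, which is at most `w ^ j * B ^ k` times the reciprocal of
  -- the product.
  have hdiff : ∀ j ≤ k, |F j - h * e j| ≤ (e j * w ^ j) * B ^ k := by
    intro j hj
    rw [hF, he, elemSymm]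
    simp only
    rw [Finset.mul_sum, ← Finset.sum_sub_distrib, Finset.sum_mul, Finset.sum_mul]
    refine (Finset.abs_sum_le_sum_abs _ _).trans (Finset.sum_le_sum fun T hT => ?_)
    obtain ⟨hTP, hTc⟩ := Finset.mem_powersetCard.1 hT
    have hpos : (0 : ℝ) < ((∏ p ∈ T, p : ℕ) : ℝ) := by exact_mod_cast hprod_pos j T hT
    have h1 : ∏ p ∈ T, 1 / (p : ℝ) = 1 / ((∏ p ∈ T, p : ℕ) : ℝ) := by
      push_cast
      simp
    have h2 : |((h / ∏ p ∈ T, p : ℕ) : ℝ) - h * (1 / ((∏ p ∈ T, p : ℕ) : ℝ))| ≤ 1 := by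
      have h3 := Nat.lt_floor_add_one ((h : ℝ) / ((∏ p ∈ T, p : ℕ) : ℝ))
      have h4 : ((h / ∏ p ∈ T, p : ℕ) : ℝ) ≤ (h : ℝ) / ((∏ p ∈ T, p : ℕ) : ℝ) :=
        Nat.cast_div_le
      rw [Nat.floor_div_eq_div] at h3
      rw [mul_one_div, abs_le]
      constructor <;> linarith
    have h5 : ((∏ p ∈ T, p : ℕ) : ℝ) ≤ (w : ℝ) ^ j * B ^ k := by
      push_cast
      calc ∏ p ∈ T, (p : ℝ) ≤ ∏ _p ∈ T, (w * B : ℝ) :=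
            Finset.prod_le_prod (fun p _ => by positivity) fun p hp => hpB p (hTP hp)
        _ = (w : ℝ) ^ j * B ^ j := by rw [Finset.prod_const, hTc, mul_pow]
        _ ≤ _ := by gcongr
    rw [h1]
    refine h2.trans ?_
    rw [mul_assoc, one_div_mul_eq_div, le_div_iff₀ hpos]
    linarith
  have hlow : |∑ j ∈ Finset.range (k + 1), (-1) ^ j * (F j - h * e j)| ≤ h * e (k + 1) / 4 := by
    have h1 : |∑ j ∈ Finset.range (k + 1), (-1) ^ j * (F j - h * e j)| ≤
        (∑ j ∈ Finset.range (k + 1), e j * (w : ℝ) ^ j) * B ^ k := by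
      rw [Finset.sum_mul]
      refine (Finset.abs_sum_le_sum_abs _ _).trans (Finset.sum_le_sum fun j hj => ?_)
      rw [abs_mul, abs_pow, abs_neg, abs_one, one_pow, one_mul]
      exact hdiff j (by have := Finset.mem_range.1 hj; omega)
    -- Since `2 * a ≤ w`, the terms at least double, so the last one controls the sum.
    have h2 : ∑ j ∈ Finset.range k, e j * (w : ℝ) ^ j ≤ e k * (w : ℝ) ^ k := by
      refine sum_range_le_of_doubling (g := fun j => e j * (w : ℝ) ^ j)
        (by simpa using he0 0) fun j hj => ?_
      have h3 := hstep j hj.le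
      calc 2 * (e j * (w : ℝ) ^ j) ≤ 2 * (a * e (j + 1) * (w : ℝ) ^ j) := by gcongr
        _ = e (j + 1) * ((2 * a) * (w : ℝ) ^ j) := by ring
        _ ≤ e (j + 1) * (w * (w : ℝ) ^ j) := by
          gcongr
          · exact he0 _
          · linarith
        _ = _ := by ring
    rw [Finset.sum_range_succ (fun j => e j * (w : ℝ) ^ j)] at h1
    refine h1.trans ?_
    calc _ ≤ (2 * (e k * (w : ℝ) ^ k)) * B ^ k := by gcongr; linarith
      _ ≤ (2 * ((a * e (k + 1)) * (w : ℝ) ^ k)) * B ^ k := by gcongr; exact hstep k le_rfl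
      _ = (16 * a * B ^ k) * (w : ℝ) ^ k * e (k + 1) / 8 := by ring
      _ ≤ w * (w : ℝ) ^ k * e (k + 1) / 8 := by gcongr; exact he0 _
      _ = ((w : ℝ) ^ (k + 1) / 2) * e (k + 1) / 4 := by ring
      _ ≤ _ := by gcongr; exact he0 _
  have hhigh : ∀ M, |∑ i ∈ Finset.range M,
      (-1) ^ (k + 2 + i) * (F (k + 2 + i) - h * e (k + 2 + i))| ≤ h * e (k + 1) / 4 := by
    intro M
    -- The bound on the sum of reciprocals makes the tail geometric: it totals at most `2 * e (k +
    -- 2) ≤ e (k + 1) / 4`.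
    have hratio : ∀ j, k + 1 ≤ j → 8 * e (j + 1) ≤ e j := by
      intro j hj
      have h1 := succ_mul_elemSymm_succ_le hf P j
      rw [← he] at h1
      have hj' : (k : ℝ) + 1 ≤ j := by exact_mod_cast hj
      have h2 : (∑ p ∈ P, 1 / (p : ℝ)) * e j ≤ ((j + 1) / 8) * e j :=
        mul_le_mul_of_nonneg_right (by linarith) (he0 j)
      have h3 : ((j : ℝ) + 1) * (8 * e (j + 1)) ≤ (j + 1) * e j := by linarith
      exact le_of_mul_le_mul_left h3 (by positivity)
    have h1 := sum_range_le_two_mul (g := fun i => e (k + 2 + i)) (fun i => he0 _)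
      (fun i => by
        have := hratio (k + 2 + i) (by omega)
        have := he0 (k + 2 + i + 1)
        change 2 * e (k + 2 + i + 1) ≤ e (k + 2 + i)
        linarith) M
    have h2 := hratio (k + 1) le_rfl
    have h3 : |∑ i ∈ Finset.range M,
        (-1) ^ (k + 2 + i) * (F (k + 2 + i) - h * e (k + 2 + i))| ≤
        h * ∑ i ∈ Finset.range M, e (k + 2 + i) := by
      rw [Finset.mul_sum]
      refine (Finset.abs_sum_le_sum_abs _ _).trans (Finset.sum_le_sum fun i _ => ?_)
      rw [abs_mul, abs_pow, abs_neg, abs_one, one_pow, one_mul, hF0 _ (by omega), zero_sub,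
        abs_neg, abs_of_nonneg (mul_nonneg (by positivity) (he0 _))]
    refine h3.trans ?_
    calc (h : ℝ) * ∑ i ∈ Finset.range M, e (k + 2 + i) ≤ h * (e (k + 1) / 4) := by
          gcongr
          change _ ≤ 2 * e (k + 1 + 1) at h1
          linarith
      _ = _ := by ring
  obtain ⟨M, hM⟩ : ∃ M, P.card + 1 = k + 2 + M := ⟨P.card - (k + 1), by omega⟩
  have hexp : (coprimeCount (∏ p ∈ P, p) 0 h : ℝ) - h * ∏ p ∈ P, (1 - 1 / (p : ℝ)) =
      ∑ j ∈ Finset.range (k + 1), (-1) ^ j * (F j - h * e j) + (-1) ^ k * (h * e (k + 1)) +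
      ∑ i ∈ Finset.range M, (-1) ^ (k + 2 + i) * (F (k + 2 + i) - h * e (k + 2 + i)) := by
    rw [coprimeCount_prod_eq hP, prod_one_sub_eq_sum_elemSymm, Finset.mul_sum,
      ← Finset.sum_sub_distrib, hM, Finset.sum_range_add, Finset.sum_range_succ]
    congr 1
    · congr 1
      · exact Finset.sum_congr rfl fun j _ => by rw [hF]; ring
      · have := hF0 (k + 1) le_rfl
        rw [hF] at this
        simp only at this
        rw [this, pow_succ]
        ring
    · exact Finset.sum_congr rfl fun j _ => by rw [hF]; ring
  rw [hexp]
  set X := ∑ j ∈ Finset.range (k + 1), (-1) ^ j * (F j - h * e j)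
  set Y := ∑ i ∈ Finset.range M, (-1) ^ (k + 2 + i) * (F (k + 2 + i) - h * e (k + 2 + i))
  have hY := hhigh M
  rw [abs_le] at hlow hY
  rcases neg_one_pow_eq_or ℝ k with hk | hk <;> rw [hk] <;> linarith

/-! ### Finding a tight cluster of prime factors -/

lemma sum_log_div_le_of_log_le {t : ℝ} (ht : 0 ≤ t) {s : Finset ℕ}
    (hs : ∀ p ∈ s, p.Prime ∧ Real.log p ≤ t) : ∑ p ∈ s, Real.log p / p ≤ t + 2 := by
  have hpos : 0 < ⌊Real.exp t⌋₊ := Nat.floor_pos.2 (Real.one_le_exp ht)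
  have h1 := sum_log_div_le (n := ⌊Real.exp t⌋₊) hpos (s := s) fun p hp => by
    have hp0 : (0 : ℝ) < p := by exact_mod_cast (hs p hp).1.pos
    exact ⟨(hs p hp).1, Nat.le_floor ((Real.log_le_iff_le_exp hp0).1 (hs p hp).2)⟩
  have h2 : Real.log ⌊Real.exp t⌋₊ ≤ t := by
    rw [Real.log_le_iff_le_exp (by exact_mod_cast hpos)]
    exact Nat.floor_le (Real.exp_pos t).le
  linarith

lemma sum_log_primeFactors_le {q : ℕ} (hq : q ≠ 0) :
    ∑ p ∈ q.primeFactors, Real.log (p : ℝ) ≤ Real.log q := by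
  rw [← Real.log_prod (fun p hp => by
    have := (Nat.prime_of_mem_primeFactors hp).pos
    positivity)]
  have hpos : 0 < ∏ p ∈ q.primeFactors, p :=
    Finset.prod_pos fun p hp => (Nat.prime_of_mem_primeFactors hp).pos
  have hle := Nat.le_of_dvd (Nat.pos_of_ne_zero hq) (Nat.prod_primeFactors_dvd q)
  have hpos' : (0 : ℝ) < ∏ p ∈ q.primeFactors, (p : ℝ) := by
    rw [← Nat.cast_prod]
    exact Nat.cast_pos.2 hpos
  refine Real.log_le_log hpos' ?_
  rw [← Nat.cast_prod]
  exact Nat.cast_le.2 hle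

/-- These primes exceed `log q`, and the logarithms of all prime factors sum to at most `log q`. -/
lemma sum_large_log_div_le_one {q : ℕ} (hq : q ≠ 0) (hlog : 0 < Real.log q) :
    ∑ p ∈ q.primeFactors.filter (fun p : ℕ => ¬ Real.log p ≤ Real.log (Real.log q)), Real.log p / p ≤ 1 := by
  have h1 : ∑ p ∈ q.primeFactors.filter (fun p : ℕ => ¬ Real.log p ≤ Real.log (Real.log q)), Real.log p / p ≤
      ∑ p ∈ q.primeFactors.filter (fun p : ℕ => ¬ Real.log p ≤ Real.log (Real.log q)),
        Real.log p / Real.log q := by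
    refine Finset.sum_le_sum fun p hp => ?_
    obtain ⟨hp1, hp2⟩ := Finset.mem_filter.1 hp
    have hp0 : (0 : ℝ) < p := by exact_mod_cast (Nat.prime_of_mem_primeFactors hp1).pos
    have h2 : Real.log q < p := (Real.log_lt_log_iff hlog hp0).1 (not_le.1 hp2)
    have := Real.log_natCast_nonneg p
    gcongr
  have h3 : ∑ p ∈ q.primeFactors.filter (fun p : ℕ => ¬ Real.log p ≤ Real.log (Real.log q)),
      Real.log p / Real.log q ≤ ∑ p ∈ q.primeFactors, Real.log p / Real.log q :=
    Finset.sum_le_sum_of_subset_of_nonneg (Finset.filter_subset _ _) fun p _ _ =>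
      div_nonneg (Real.log_natCast_nonneg p) hlog.le
  rw [← Finset.sum_div, ← Finset.sum_div] at h3
  rw [← Finset.sum_div] at h1
  have h4 := (div_le_one hlog).2 (sum_log_primeFactors_le hq)
  linarith

lemma primeLogSum_le {q : ℕ} (hq : q ≠ 0) (hlog : 1 ≤ Real.log q) :
    primeLogSum q ≤ Real.log (Real.log q) + 3 := by
  rw [primeLogSum, ← Finset.sum_filter_add_sum_filter_not q.primeFactors
    (fun p : ℕ => Real.log p ≤ Real.log (Real.log q))]
  have h1 := sum_large_log_div_le_one hq (by linarith)
  have h2 := sum_log_div_le_of_log_le (Real.log_nonneg hlog)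
    (s := q.primeFactors.filter fun p : ℕ => Real.log p ≤ Real.log (Real.log q)) fun p hp =>
    ⟨Nat.prime_of_mem_primeFactors (Finset.mem_filter.1 hp).1, (Finset.mem_filter.1 hp).2⟩
  linarith

/-- A set of primes in a long logarithmic range has a subset which is short in logarithmic scale
and keeps a fair share of the sum of reciprocals. -/
lemma exists_log_close_subset {P₀ : Finset ℕ} {A D : ℝ} (hD : 0 < D) (hA : 0 ≤ A)
    (hP₀ : ∀ p ∈ P₀, Real.log p ≤ A) :
    ∃ P ⊆ P₀, (∑ p ∈ P₀, 1 / (p : ℝ)) / (A / D + 1) ≤ ∑ p ∈ P, 1 / (p : ℝ) ∧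
      ∀ p ∈ P, ∀ r ∈ P, Real.log p ≤ Real.log r + D := by
  -- Pigeonhole over the at most `A / D + 1` windows of length `D` for `log p`.
  obtain ⟨i, -, hi⟩ := Finset.exists_le_sum_fiber_of_maps_to_of_nsmul_le_sum
    (s := P₀) (t := Finset.range (⌊A / D⌋₊ + 1)) (f := fun p : ℕ => ⌊Real.log p / D⌋₊)
    (w := fun p : ℕ => 1 / (p : ℝ)) (b := (∑ p ∈ P₀, 1 / (p : ℝ)) / (A / D + 1))
    (fun p hp => by
      rw [Finset.mem_range, Nat.lt_succ_iff]
      refine Nat.floor_le_floor ?_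
      have := hP₀ p hp
      gcongr) ⟨0, by simp⟩ (by
      rw [Finset.card_range, nsmul_eq_mul, mul_div_assoc', div_le_iff₀ (by positivity), mul_comm]
      have := Nat.floor_le (show 0 ≤ A / D by positivity)
      have h0 : 0 ≤ ∑ p ∈ P₀, 1 / (p : ℝ) := Finset.sum_nonneg fun _ _ => by positivity
      push_cast
      gcongr)
  refine ⟨_, Finset.filter_subset _ _, hi, fun p hp r hr => ?_⟩
  have hp' := (Finset.mem_filter.1 hp).2
  have hr' := (Finset.mem_filter.1 hr).2
  have h1 := Nat.lt_floor_add_one (Real.log p / D)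
  have h2 := Nat.floor_le (div_nonneg (Real.log_natCast_nonneg r) hD.le)
  rw [hp'] at h1
  rw [hr'] at h2
  rw [div_lt_iff₀ hD] at h1
  rw [le_div_iff₀ hD] at h2
  linarith

/-- Here `l = log z`. Primes beyond `log q` or below `exp (16 * l)` carry less than half of the sum;
the rest is cut into logarithmic windows of width `2 * l / u`, narrow enough that `k ≤ 2 * u`
factors cost only `exp (4 * l)`. -/
lemma exists_prime_cluster {q : ℕ} (hq : q ≠ 0) {l u : ℝ} (hl : l = primeLogSum q / 1000)
    (hS : 120 ≤ primeLogSum q) (hly : 7 ≤ Real.log (Real.log q))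
    (hu : (Real.log (Real.log q) / l) ^ 3 ≤ u) (hul : u ≤ Real.exp (l / 2)) :
    500 ≤ u ∧ 2 ≤ l ∧ ∃ P ⊆ q.primeFactors, ∃ w : ℕ, (∀ p ∈ P, w ≤ p) ∧
      (∀ p ∈ P, (p : ℝ) ≤ w * Real.exp (2 * l / u)) ∧ Real.exp (16 * l) ≤ w ∧
      1 / u ^ 2 ≤ ∑ p ∈ P, 1 / (p : ℝ) ∧ ∑ p ∈ P, 1 / (p : ℝ) ≤ 2 := by
  have hlog : 1 ≤ Real.log q := by
    by_contra hcon
    have := Real.log_nonpos (Real.log_natCast_nonneg q) (not_le.1 hcon).le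
    linarith
  set S := primeLogSum q with hSdef
  set y := Real.log (Real.log q) with hy
  have hSy : S ≤ y + 3 := primeLogSum_le hq hlog
  have hl0 : 0 < l := by rw [hl]; linarith
  set L := y / l with hLdef
  have hL : 500 ≤ L := by
    rw [hLdef, le_div_iff₀ hl0, hl]
    linarith
  have hyL : y = L * l := by rw [hLdef]; field_simp
  -- The cubic lower bound on `u` enters only through this square.
  have hLu : L ^ 2 ≤ u := le_trans (pow_le_pow_right₀ (by linarith) (by norm_num)) hu
  have hu500 : 500 ≤ u := by nlinarith
  have hl2 : 2 ≤ l := by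
    by_contra hcon
    have h1 : Real.exp (l / 2) ≤ Real.exp 1 := Real.exp_le_exp.2 (by linarith)
    have := Real.exp_one_lt_d9
    linarith
  refine ⟨hu500, hl2, ?_⟩
  set P₁ := q.primeFactors.filter fun p : ℕ => Real.log p ≤ y with hP₁
  set P₀ := P₁.filter fun p : ℕ => ¬ Real.log p ≤ 16 * l with hP₀
  have hP₀q : P₀ ⊆ q.primeFactors := (Finset.filter_subset _ _).trans (Finset.filter_subset _ _)
  -- The discarded primes contribute at most `1 + (16 * l + 2)`, where `l = S / 1000` and `S ≥ 120`.
  have hT : S / 2 ≤ ∑ p ∈ P₀, Real.log p / p := by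
    have h1 := Finset.sum_filter_add_sum_filter_not q.primeFactors
      (fun p : ℕ => Real.log p ≤ y) (fun p : ℕ => Real.log p / p)
    have h2 := Finset.sum_filter_add_sum_filter_not P₁
      (fun p : ℕ => Real.log p ≤ 16 * l) (fun p : ℕ => Real.log p / p)
    have h3 := sum_large_log_div_le_one hq (by linarith)
    have h4 := sum_log_div_le_of_log_le (t := 16 * l) (by linarith)
      (s := P₁.filter fun p : ℕ => Real.log p ≤ 16 * l) fun p hp =>
      ⟨Nat.prime_of_mem_primeFactors
        (Finset.mem_filter.1 (Finset.mem_filter.1 hp).1).1, (Finset.mem_filter.1 hp).2⟩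
    have h5 : S = ∑ p ∈ q.primeFactors, Real.log p / p := rfl
    linarith
  have hR : 500 / L ≤ ∑ p ∈ P₀, 1 / (p : ℝ) := by
    have h1 : ∑ p ∈ P₀, Real.log p / p ≤ y * ∑ p ∈ P₀, 1 / (p : ℝ) := by
      rw [Finset.mul_sum]
      refine Finset.sum_le_sum fun p hp => ?_
      have := (Finset.mem_filter.1 (Finset.mem_filter.1 hp).1).2
      rw [mul_one_div]
      gcongr
    have h2 : S / 2 = 500 * l := by rw [hl]; ring
    rw [div_le_iff₀ (by linarith)]
    have h3 : l * 500 ≤ l * ((∑ p ∈ P₀, 1 / (p : ℝ)) * L) := by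
      calc l * 500 = S / 2 := by rw [h2]; ring
        _ ≤ y * ∑ p ∈ P₀, 1 / (p : ℝ) := hT.trans h1
        _ = _ := by rw [hyL]; ring
    exact le_of_mul_le_mul_left h3 hl0
  have hD : 0 < 2 * l / u := by positivity
  have hDl : 2 * l / u ≤ l := by
    rw [div_le_iff₀ (by linarith)]
    nlinarith
  obtain ⟨P, hPP₀, hsum, hclose⟩ := exists_log_close_subset hD (A := y) (P₀ := P₀) (by linarith)
    fun p hp => (Finset.mem_filter.1 (Finset.mem_filter.1 hp).1).2
  have hlow : 1 / u ^ 2 ≤ ∑ p ∈ P, 1 / (p : ℝ) := by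
    refine le_trans ?_ hsum
    have h1 : y / (2 * l / u) + 1 ≤ u * L := by
      have : y / (2 * l / u) = u * L / 2 := by rw [hyL]; field_simp
      nlinarith
    have hL0 : 0 < L := by linarith
    have hu0 : 0 < u := by linarith
    calc 1 / u ^ 2 = 1 / (u * u) := by ring
      _ ≤ 1 / (u * L ^ 2) := by gcongr
      _ ≤ 500 / (u * L ^ 2) := by gcongr; norm_num
      _ = (500 / L) / (u * L) := by field_simp
      _ ≤ (∑ p ∈ P₀, 1 / (p : ℝ)) / (y / (2 * l / u) + 1) := by
        gcongr
  have hne : P.Nonempty := by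
    by_contra hcon
    rw [Finset.not_nonempty_iff_eq_empty.1 hcon, Finset.sum_empty] at hlow
    have : 0 < 1 / u ^ 2 := by positivity
    linarith
  have hmem := P.min'_mem hne
  set w := P.min' hne with hw
  have hprime : ∀ p ∈ P, p.Prime := fun p hp =>
    Nat.prime_of_mem_primeFactors (hP₀q (hPP₀ hp))
  have hw0 : (0 : ℝ) < w := by exact_mod_cast (hprime w hmem).pos
  have hwl : 16 * l < Real.log w := not_le.1 (Finset.mem_filter.1 (hPP₀ hmem)).2
  refine ⟨P, hPP₀.trans hP₀q, w, fun p hp => P.min'_le p hp, fun p hp => ?_,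
    (Real.le_log_iff_exp_le hw0).1 hwl.le, hlow, ?_⟩
  · have hp0 : (0 : ℝ) < p := by exact_mod_cast (hprime p hp).pos
    have := (Real.log_le_iff_le_exp hp0).1 (hclose p hp w hmem)
    rwa [Real.exp_add, Real.exp_log hw0] at this
  -- All these logarithms are at least `log w`, while Mertens bounds the weighted sum by `log w + 2
  -- * l / u + 2 ≤ 2 * log w`.
  · have h1 := sum_log_div_le_of_log_le (t := Real.log w + 2 * l / u) (by linarith) (s := P)
      fun p hp => ⟨hprime p hp, hclose p hp w hmem⟩
    have h2 : Real.log w * ∑ p ∈ P, 1 / (p : ℝ) ≤ ∑ p ∈ P, Real.log p / p := by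
      rw [Finset.mul_sum]
      refine Finset.sum_le_sum fun p hp => ?_
      have h3 : Real.log w ≤ Real.log p :=
        Real.log_le_log hw0 (by exact_mod_cast P.min'_le p hp)
      rw [mul_one_div]
      gcongr
    have h3 : Real.log w * ∑ p ∈ P, 1 / (p : ℝ) ≤ Real.log w * 2 := by linarith
    exact le_of_mul_le_mul_left h3 (by linarith)

/-! ### A biased divisor of `q` -/

lemma totient_prod_div {P : Finset ℕ} (hP : ∀ p ∈ P, p.Prime) :
    (Nat.totient (∏ p ∈ P, p) : ℝ) / ((∏ p ∈ P, p : ℕ) : ℝ) = ∏ p ∈ P, (1 - 1 / (p : ℝ)) := by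
  have h1 := Nat.totient_eq_mul_prod_factors (∏ p ∈ P, p)
  rw [Nat.primeFactors_prod hP] at h1
  have h2 : (Nat.totient (∏ p ∈ P, p) : ℝ) =
      ((∏ p ∈ P, p : ℕ) : ℝ) * ∏ p ∈ P, (1 - (p : ℝ)⁻¹) := by
    have h4 := congrArg (Rat.cast (K := ℝ)) h1
    push_cast at h4 ⊢
    exact h4
  have h3 : ((∏ p ∈ P, p : ℕ) : ℝ) ≠ 0 := by
    exact_mod_cast (Finset.prod_pos fun p hp => (hP p hp).pos).ne'
  rw [h2, mul_div_cancel_left₀ _ h3]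
  simp

lemma exists_deviation {q : ℕ} (hq : q ≠ 0) {l u : ℝ} (hl : l = primeLogSum q / 1000)
    (hS : 120 ≤ primeLogSum q) (hly : 7 ≤ Real.log (Real.log q))
    (hu : (Real.log (Real.log q) / l) ^ 3 ≤ u) (hul : u ≤ Real.exp (l / 2))
    {k : ℕ} (hk : u ≤ k) (hk' : (k : ℝ) + 1 ≤ 2 * u) :
    ∃ Q h : ℕ, Q ∣ q ∧ Real.exp (l * u) ≤ h ∧
      1 / u ^ (9 * u) * ((Nat.totient Q : ℝ) / Q) * h ≤
        (-1) ^ k * (coprimeCount Q 0 h - ((Nat.totient Q : ℝ) / Q) * h) := by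
  obtain ⟨hu500, hl2, P, hPq, w, hw, hpw, hlw, hlow, hup⟩ :=
    exists_prime_cluster hq hl hS hly hu hul
  have hP : ∀ p ∈ P, p.Prime := fun p hp => Nat.prime_of_mem_primeFactors (hPq hp)
  have hu0 : 0 < u := by linarith
  have hw0 : (0 : ℝ) < w := lt_of_lt_of_le (Real.exp_pos _) hlw
  have hB : 1 ≤ Real.exp (2 * l / u) := Real.one_le_exp (by positivity)
  have hBk : Real.exp (2 * l / u) ^ k ≤ Real.exp (4 * l) := by
    rw [← Real.exp_nat_mul]
    refine Real.exp_le_exp.2 ?_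
    rw [mul_div_assoc', div_le_iff₀ hu0]
    nlinarith
  have hu4 : u ^ 4 ≤ Real.exp (2 * l) := by
    calc u ^ 4 ≤ Real.exp (l / 2) ^ 4 := by gcongr
      _ = _ := by rw [← Real.exp_nat_mul]; congr 1; push_cast; ring
  have hu4w : u ^ 4 ≤ w := hu4.trans ((Real.exp_le_exp.2 (by linarith)).trans hlw)
  have hexp16 : 16 ≤ Real.exp (10 * l) := by
    have := Real.exp_le_exp.2 (show l / 2 ≤ 10 * l by linarith)
    linarith
  -- The exponent `16 * l` is spent as `10 * l` for the constant, `2 * l` for `u ^ 4` and `4 * l`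
  -- for the spread of the cluster.
  have hab : 16 * u ^ 4 * Real.exp (2 * l / u) ^ k ≤ w := by
    calc _ ≤ Real.exp (10 * l) * Real.exp (2 * l) * Real.exp (4 * l) := by gcongr
      _ = Real.exp (16 * l) := by rw [← Real.exp_add, ← Real.exp_add]; congr 1; ring
      _ ≤ w := hlw
  set e := elemSymm (fun p : ℕ => 1 / (p : ℝ)) P with he
  have hf : ∀ p : ℕ, 0 ≤ 1 / (p : ℝ) := fun p => by positivity
  have he0 : ∀ j, 0 ≤ e j := fun j => elemSymm_nonneg hf P j
  -- Every reciprocal is at most `1 / u ^ 4`, so deleting `j` of them barely affects a sum of at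
  -- least `1 / u ^ 2`: the point is `2 * j + 1 ≤ u ^ 2`.
  have hstep : ∀ j ≤ k, e j ≤ u ^ 4 * e (j + 1) := by
    intro j hj
    have h1 := le_succ_mul_elemSymm_succ hf (s := P) (b := 1 / u ^ 4) (fun p hp => by
      have : (w : ℝ) ≤ p := by exact_mod_cast hw p hp
      gcongr
      linarith) j
    have hj' : (j : ℝ) ≤ k := by exact_mod_cast hj
    have h2 : ((j : ℝ) + 1) / u ^ 4 ≤ ∑ p ∈ P, 1 / (p : ℝ) - j * (1 / u ^ 4) := by
      have h3 : ((j : ℝ) + 1) / u ^ 4 + j * (1 / u ^ 4) ≤ 1 / u ^ 2 := by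
        rw [mul_one_div, ← add_div, div_le_div_iff₀ (by positivity) (by positivity)]
        have h5 : (j : ℝ) + 1 + j ≤ u ^ 2 := by nlinarith
        calc _ ≤ u ^ 2 * u ^ 2 := by gcongr
          _ = _ := by ring
      linarith
    have h4 := (mul_le_mul_of_nonneg_right h2 (he0 j)).trans h1
    rw [div_mul_eq_mul_div, div_le_iff₀ (by positivity)] at h4
    have h5 : ((j : ℝ) + 1) * e j ≤ (j + 1) * (u ^ 4 * e (j + 1)) := by
      rw [he] at h4 ⊢
      linarith
    exact le_of_mul_le_mul_left h5 (by positivity)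
  have hdev := coprimeCount_deviation hP hw hB hpw (k := k) (a := u ^ 4)
    (one_le_pow₀ (by linarith)) hstep hab (by linarith)
  have hek : ∀ j ≤ k + 1, 1 ≤ (u ^ 4) ^ j * e j := by
    intro j hj
    induction j with
    | zero => rw [he, elemSymm_zero]; norm_num
    | succ j ih =>
      calc (1 : ℝ) ≤ (u ^ 4) ^ j * e j := ih (by omega)
        _ ≤ (u ^ 4) ^ j * (u ^ 4 * e (j + 1)) := by gcongr; exact hstep j (by omega)
        _ = _ := by ring
  -- Iterating `hstep` gives `u ^ (-4 * (k + 1))`, at least `u ^ (-8 * u)`; the ninth `u` absorbs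
  -- the factor `2`.
  have hsmall : 1 / u ^ (9 * u) ≤ e (k + 1) / 2 := by
    have h1 : (u ^ 4) ^ (k + 1) ≤ u ^ (8 * u) := by
      rw [← pow_mul, ← Real.rpow_natCast]
      refine Real.rpow_le_rpow_of_exponent_le (by linarith) ?_
      push_cast
      linarith
    have h2 : 2 ≤ u ^ u := by
      calc (2 : ℝ) ≤ u ^ (1 : ℝ) := by rw [Real.rpow_one]; linarith
        _ ≤ u ^ u := Real.rpow_le_rpow_of_exponent_le (by linarith) (by linarith)
    have h3 : u ^ (9 * u) = u ^ (8 * u) * u ^ u := by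
      rw [← Real.rpow_add hu0]; congr 1; ring
    have h4 := hek (k + 1) le_rfl
    have h5 : 1 ≤ u ^ (8 * u) * e (k + 1) :=
      h4.trans (mul_le_mul_of_nonneg_right h1 (he0 _))
    rw [div_le_iff₀ (by positivity), h3]
    calc (1 : ℝ) ≤ u ^ (8 * u) * e (k + 1) := h5
      _ = u ^ (8 * u) * e (k + 1) / 2 * 2 := by ring
      _ ≤ u ^ (8 * u) * e (k + 1) / 2 * u ^ u := by
        have := he0 (k + 1)
        gcongr
      _ = _ := by ring
  refine ⟨∏ p ∈ P, p, w ^ (k + 1) - 1, ?_, ?_, ?_⟩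
  · exact (Finset.prod_dvd_prod_of_subset _ _ _ hPq).trans (Nat.prod_primeFactors_dvd q)
  · have hw2 : (2 : ℝ) ≤ w := by
      have : u ≤ u ^ 4 := le_self_pow₀ (by linarith) (by norm_num)
      linarith
    have hw2' : 2 ≤ w := by exact_mod_cast hw2
    have h1 : w ^ k ≤ w ^ (k + 1) - 1 := by
      have : w ^ (k + 1) = w ^ k * w := pow_succ _ _
      have h2 : 1 ≤ w ^ k := Nat.one_le_pow _ _ (by omega)
      have h3 : w ^ k * 2 ≤ w ^ k * w := Nat.mul_le_mul_left _ hw2'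
      omega
    calc Real.exp (l * u) ≤ Real.exp (k * (16 * l)) := by
          refine Real.exp_le_exp.2 ?_
          nlinarith
      _ = Real.exp (16 * l) ^ k := by rw [← Real.exp_nat_mul]
      _ ≤ (w : ℝ) ^ k := by gcongr
      _ ≤ _ := by exact_mod_cast h1
  · rw [totient_prod_div hP]
    have hle1 : ∏ p ∈ P, (1 - 1 / (p : ℝ)) ≤ 1 := by
      refine Finset.prod_le_one (fun p hp => ?_) fun p _ => by linarith [hf p]
      have : (1 : ℝ) ≤ p := by exact_mod_cast (hP p hp).one_le
      have := (div_le_one (by linarith)).2 this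
      linarith
    rw [mul_comm (∏ p ∈ P, (1 - 1 / (p : ℝ))) _]
    refine le_trans ?_ hdev
    have hee := he0 (k + 1)
    have hpos : 0 ≤ 1 / u ^ (9 * u) := by positivity
    calc _ ≤ 1 / u ^ (9 * u) * 1 * ((w ^ (k + 1) - 1 : ℕ) : ℝ) := by gcongr
      _ ≤ e (k + 1) / 2 * 1 * ((w ^ (k + 1) - 1 : ℕ) : ℝ) := by gcongr
      _ = _ := by ring

/-! ### Assembly -/

lemma zParam_eq_exp (c : ℝ) (q : ℕ) : zParam c q = Real.exp (c * primeLogSum q) := by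
  have hpos : ∀ p ∈ q.primeFactors, (0 : ℝ) < (p : ℝ) := fun p hp => by
    exact_mod_cast (Nat.prime_of_mem_primeFactors hp).pos
  have h1 : ∏ p ∈ q.primeFactors, (p : ℝ) ^ (1 / (p : ℝ)) = Real.exp (primeLogSum q) := by
    rw [primeLogSum, Real.exp_sum]
    refine Finset.prod_congr rfl fun p hp => ?_
    rw [Real.rpow_def_of_pos (hpos p hp)]
    congr 1
    ring
  rw [zParam, h1, ← Real.exp_mul, mul_comm]

theorem corollary1p2 :
    ∃ c₁ : ℝ, 0 < c₁ ∧ ∃ c₂ : ℝ, 0 < c₂ ∧ ∃ C : ℝ, 0 < C ∧ ∃ q₀ : ℕ,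
      ∀ q : ℕ, q₀ ≤ q → Squarefree q →
        60 * Real.log (Real.log (Real.log (q : ℝ))) ≤ primeLogSum q →
        ∀ u : ℝ,
          C * (Real.log (Real.log (q : ℝ)) / Real.log (zParam c₁ q)) ^ 3 ≤ u →
          u ≤ Real.sqrt (zParam c₁ q) →
          (∃ m h : ℕ, zParam c₁ q ^ u ≤ (h : ℝ) ∧
            (1 + 1 / u ^ (c₂ * u)) * ((Nat.totient q : ℝ) / (q : ℝ)) * (h : ℝ)
              ≤ (coprimeCount q m h : ℝ)) ∧
          (∃ m h : ℕ, zParam c₁ q ^ u ≤ (h : ℝ) ∧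
            (coprimeCount q m h : ℝ)
              ≤ (1 - 1 / u ^ (c₂ * u)) * ((Nat.totient q : ℝ) / (q : ℝ)) * (h : ℝ)) := by
  -- The choice of `q₀` makes the triple logarithm at least `2`, so the hypothesis gives
  -- `primeLogSum q ≥ 120`.
  refine ⟨1 / 1000, by norm_num, 9, by norm_num, 1, by norm_num,
    ⌈Real.exp (Real.exp (Real.exp 2))⌉₊, fun q hq₀ hsq hS u hu hul => ?_⟩
  have hq : q ≠ 0 := hsq.ne_zero
  have hqpos : (0 : ℝ) < q := by exact_mod_cast Nat.pos_of_ne_zero hq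
  have hlog1 : Real.exp (Real.exp 2) ≤ Real.log q :=
    (Real.le_log_iff_exp_le hqpos).2 (Nat.ceil_le.1 hq₀)
  have hlog2 : Real.exp 2 ≤ Real.log (Real.log q) :=
    (Real.le_log_iff_exp_le ((Real.exp_pos _).trans_le hlog1)).2 hlog1
  have hlog3 : 2 ≤ Real.log (Real.log (Real.log q)) :=
    (Real.le_log_iff_exp_le ((Real.exp_pos _).trans_le hlog2)).2 hlog2
  have hexp2 : 7 ≤ Real.exp 2 := by
    have h1 : Real.exp 2 = Real.exp 1 * Real.exp 1 := by rw [← Real.exp_add]; norm_num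
    have := Real.exp_one_gt_d9
    nlinarith
  set l := primeLogSum q / 1000 with hl
  have hz : zParam (1 / 1000) q = Real.exp l := by
    rw [zParam_eq_exp]; congr 1; rw [hl]; ring
  rw [hz, Real.log_exp, one_mul] at hu
  rw [hz, ← Real.exp_half] at hul
  rw [hz, ← Real.exp_mul]
  have hdev : ∀ k : ℕ, u ≤ k → (k : ℝ) + 1 ≤ 2 * u → _ := fun k hk hk' =>
    exists_deviation hq hl (by linarith) (by linarith) hu hul (k := k) hk hk'
  have hu500 : 500 ≤ u :=
    (exists_prime_cluster hq hl (by linarith) (by linarith) hu hul).1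
  have hceil : ((⌈u⌉₊ : ℕ) : ℝ) < u + 1 := Nat.ceil_lt_add_one (by linarith)
  have hceil' : u ≤ ((⌈u⌉₊ : ℕ) : ℝ) := Nat.le_ceil u
  have hsplit : ∀ Q, Q ∣ q → ∃ R, q = Q * R ∧ 0 < Q ∧ 0 < R ∧ Q.Coprime R := by
    rintro Q ⟨R, rfl⟩
    exact ⟨R, rfl, Nat.pos_of_ne_zero (left_ne_zero_of_mul hq),
      Nat.pos_of_ne_zero (right_ne_zero_of_mul hq), Nat.coprime_of_squarefree_mul hsq⟩
  -- Of `⌈u⌉₊` and `⌈u⌉₊ + 1`, the even one serves as `k` for the excess and the odd one for the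
  -- deficit.
  obtain ⟨a, b, ha, hb, ha1, ha2, hb1, hb2⟩ : ∃ a b : ℕ, Even a ∧ Odd b ∧
      ⌈u⌉₊ ≤ a ∧ a ≤ ⌈u⌉₊ + 1 ∧ ⌈u⌉₊ ≤ b ∧ b ≤ ⌈u⌉₊ + 1 := by
    rcases Nat.even_or_odd ⌈u⌉₊ with h | h
    · exact ⟨_, _, h, h.add_one, by omega, by omega, by omega, by omega⟩
    · exact ⟨_, _, h.add_one, h, by omega, by omega, by omega, by omega⟩
  have ha1' : ((⌈u⌉₊ : ℕ) : ℝ) ≤ a := by exact_mod_cast ha1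
  have ha2' : (a : ℝ) ≤ (⌈u⌉₊ : ℕ) + 1 := by exact_mod_cast ha2
  have hb1' : ((⌈u⌉₊ : ℕ) : ℝ) ≤ b := by exact_mod_cast hb1
  have hb2' : (b : ℝ) ≤ (⌈u⌉₊ : ℕ) + 1 := by exact_mod_cast hb2
  constructor
  · obtain ⟨Q, h, hQ, hh, hd⟩ := hdev a (by linarith) (by linarith)
    obtain ⟨R, rfl, hQ0, hR0, hQR⟩ := hsplit Q hQ
    rw [ha.neg_one_pow, one_mul] at hd
    obtain ⟨m, hm⟩ := exists_le_coprimeCount_mul hQ0 hR0 hQR (h := h)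
      (c := 1 + 1 / u ^ (9 * u)) (by linarith)
    exact ⟨m, h, hh, hm⟩
  · obtain ⟨Q, h, hQ, hh, hd⟩ := hdev b (by linarith) (by linarith)
    obtain ⟨R, rfl, hQ0, hR0, hQR⟩ := hsplit Q hQ
    rw [hb.neg_one_pow] at hd
    obtain ⟨m, hm⟩ := exists_coprimeCount_mul_le hQ0 hR0 hQR (h := h)
      (c := 1 - 1 / u ^ (9 * u)) (by linarith)
    exact ⟨m, h, hh, hm⟩
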